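/- Calculus is understood in the sense of Bastiani: a map $f\colon U\to F$ from an open subset $U$ of a Hausdorff locally convex space $E$ to a Hausdorff locally convex space $F$ is $C^k$ if, for all $j\le k$, the iterated directional derivatives $d^jf(x;v_1,\dots,v_j)$ exist and define continuous maps $U\times E^j\to F$; it is smooth if it is $C^k$ for all $k$. Manifolds are Hausdorff smooth manifolds modelled on Hausdorff locally convex spaces. Let $M$ be such a manifold. A weak Riemannian metric on $M$ is a smooth map $g\colon TM\oplus TM\to\mathbb R$ such that every $g_p$ is a symmetric, positive definite bilinear form on $T_pM$. A spray is a smooth vector field $S\colon TM\to T(TM)$ on $TM$ with $T\pi_M\circ S=\mathrm{id}_{TM}$ and $S\circ h_\lambda=Th_\lambda(\lambda S)$ for all $\lambda\in\mathbb R$, where $h_\lambda$ is fibrewise multiplication by $\lambda$; in a chart $U$ it has the form $(x,v)\mapsto(x,v,v,\Gamma_U(x,v))$, and we put $B_U(x,v,w)=\tfrac12\,d_2^2\Gamma_U(x,0;(v,w))$. The spray is a metric spray of $g$ if in every chart $g_U(x,\Gamma_U(x,v),w)=\tfrac12 d_1g_U(x,v,v;w)-d_1g_U(x,v,w;v)$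 for all $x,v,w$. A Hesse manifold is a weak Riemannian manifold $(M,g)$ that admits a metric spray; its covariant derivative is the one associated with the metric spray, given in charts by $(\nabla_vX)(x)=dX(x;v)-B_U(x,v,X(x))$. **Proposition.** Let $(M,g)$ be a Hesse manifold and let $f\colon M\to\mathbb R$ be a smooth gradient-admitting function, i.e. $f$ has a Riemannian gradient: a vector field $\nabla f$ with $D_pf(v)=g_p(\nabla f(p),v)$ for all $p\in M$, $v\in T_pM$; assume $\nabla f$ is of class $C^1$ (for instance smooth), so that the Riemannian Hessian $\mathrm{Hess} f(p)\colon T_pM\to T_pM$, $v\mapsto\nabla_v\nabla f$, is defined. Then $x\in M$ is a second-order critical point of $f$ if and only if $\nabla f(x)=0$ and $\mathrm{Hess} f(x)$ is positive semidefinite, i.e. $g_x(\mathrm{Hess} f(x)[v],v)\ge 0$ for all $v\in T_xM$. Here $p\in M$ is a critical point of $f$ if $(f\circ\gamma)'(0)\ge 0$ for all $C^1$ curves $\gamma\colon I\to M$ on open intervals $I\ni 0$ with $\gamma(0)=p$, and a second-order critical point if it is a critical point and moreover $(f\circ c)''(0)\ge0$ for all smooth curves $c\colon I\to M$ on open intervals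 $I\ni 0$ with $c(0)=p$. -/

import Mathlib

open Set Filter Topology

universe u v w

noncomputable section

/-! ### Bastiani calculus on locally convex spaces -/

namespace Bastiani

/-- `y` is the directional derivative of `f` at `x` in the direction `v`, i.e. the limit of
`t⁻¹ (f (x + t v) - f x)` as `t → 0`, `t ≠ 0`. -/
def HasDirDeriv {E F : Type*} [AddCommGroup E] [Module ℝ E] [AddCommGroup F] [Module ℝ F]
    [TopologicalSpace F] (f : E → F) (x v : E) (y : F) : Prop :=
  Tendsto (fun t : ℝ => t⁻¹ • (f (x + t • v) - f x)) (𝓝[≠] 0) (𝓝 y)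

/-- The directional derivative `df(x; v)` (meaningful when the limit exists). -/
def dirDeriv {E F : Type*} [AddCommGroup E] [Module ℝ E] [AddCommGroup F] [Module ℝ F]
    [TopologicalSpace F] (f : E → F) (x v : E) : F :=
  limUnder (𝓝[≠] (0 : ℝ)) (fun t : ℝ => t⁻¹ • (f (x + t • v) - f x))

/-- Iterated directional derivatives: `iterDirDeriv [v₁, …, vₖ] f x` is `D_{v₁} ⋯ D_{vₖ} f (x)`. -/
def iterDirDeriv {E F : Type*} [AddCommGroup E] [Module ℝ E] [AddCommGroup F] [Module ℝ F]
    [TopologicalSpace F] : List E → (E → F) → E → F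
  | [], f => f
  | v :: vs, f => fun x => dirDeriv (iterDirDeriv vs f) x v

/-- `f` is `C^k` (in the sense of Bastiani) on the open set `U`: for every `j ≤ k` the iterated
directional derivative `d^j f (x; v₁, …, vⱼ)` exists for all `x ∈ U` and all directions, and
`d^j f : U × E^j → F` is continuous. -/
def IsCk {E F : Type*} [AddCommGroup E] [Module ℝ E] [TopologicalSpace E]
    [AddCommGroup F] [Module ℝ F] [TopologicalSpace F] (k : ℕ) (f : E → F) (U : Set E) : Prop :=
  (∀ vs : List E, vs.length < k → ∀ x ∈ U, ∀ v : E,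
      ∃ y : F, HasDirDeriv (iterDirDeriv vs f) x v y) ∧
    ∀ j ≤ k, ContinuousOn (fun z : E × (Fin j → E) => iterDirDeriv (List.ofFn z.2) f z.1)
      (U ×ˢ univ)

/-- `f` is smooth (in the sense of Bastiani) on the open set `U`. -/
def IsSmooth {E F : Type*} [AddCommGroup E] [Module ℝ E] [TopologicalSpace E]
    [AddCommGroup F] [Module ℝ F] [TopologicalSpace F] (f : E → F) (U : Set E) : Prop :=
  ∀ k : ℕ, IsCk k f U

/-! ### Manifolds modelled on locally convex spaces -/

/-- The data of an atlas on a set `M`: a family of charts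
`φᵢ = toFun i : source i → target i ⊆ E i` with inverses `invFun i`, taking values in (possibly
different) Hausdorff locally convex spaces `E i`, and a choice, for each point `p`, of a chart
`idx p` around it. The axioms making `M` a smooth manifold are in `AtlasData.IsManifold`. -/
structure AtlasData (M : Type u) where
  ι : Type v
  E : ι → Type w
  instAddCommGroup : ∀ i, AddCommGroup (E i)
  instModule : ∀ i, Module ℝ (E i)
  instTopologicalSpace : ∀ i, TopologicalSpace (E i)
  instIsTopologicalAddGroup : ∀ i, IsTopologicalAddGroup (E i)
  instContinuousSMul : ∀ i, ContinuousSMul ℝ (E i)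
  instLocallyConvexSpace : ∀ i, LocallyConvexSpace ℝ (E i)
  instT2Space : ∀ i, T2Space (E i)
  source : ι → Set M
  target : ∀ i, Set (E i)
  toFun : ∀ i, M → E i
  invFun : ∀ i, E i → M
  idx : M → ι

attribute [instance] AtlasData.instAddCommGroup AtlasData.instModule
  AtlasData.instTopologicalSpace AtlasData.instIsTopologicalAddGroup
  AtlasData.instContinuousSMul AtlasData.instLocallyConvexSpace AtlasData.instT2Space

namespace AtlasData

variable {M : Type*} {N : Type*}

/-- `A` is a smooth atlas on the topological space `M`: the charts are homeomorphisms between open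
sets, they cover `M` (`p` lies in the domain of the chart `idx p`), and all transition maps are
smooth. -/
structure IsManifold [TopologicalSpace M] (A : AtlasData M) : Prop where
  isOpen_source : ∀ i, IsOpen (A.source i)
  isOpen_target : ∀ i, IsOpen (A.target i)
  mapsTo_toFun : ∀ i, MapsTo (A.toFun i) (A.source i) (A.target i)
  mapsTo_invFun : ∀ i, MapsTo (A.invFun i) (A.target i) (A.source i)
  left_inv : ∀ i, ∀ p ∈ A.source i, A.invFun i (A.toFun i p) = p
  right_inv : ∀ i, ∀ x ∈ A.target i, A.toFun i (A.invFun i x) = x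
  continuousOn_toFun : ∀ i, ContinuousOn (A.toFun i) (A.source i)
  continuousOn_invFun : ∀ i, ContinuousOn (A.invFun i) (A.target i)
  mem_source_idx : ∀ p, p ∈ A.source (A.idx p)
  smooth_transition : ∀ i j, IsSmooth (fun x => A.toFun j (A.invFun i x))
    (A.target i ∩ A.invFun i ⁻¹' A.source j)

/-- The tangent space `T_p M`, realised as the model space of the chosen chart around `p`: the
class of a curve `c` with `c 0 = p` corresponds to the velocity of `c` at `0` in that chart. -/
abbrev TangentSpace (A : AtlasData M) (p : M) : Type _ := A.E (A.idx p)

/-- The tangent bundle `TM` as a set. -/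
abbrev TangentBundle (A : AtlasData M) : Type _ := Σ p : M, A.TangentSpace p

/-- The differential `D_p φᵢ : T_p M → E i` of the chart `φᵢ` at `p`, i.e. the local representative
of a tangent vector in the chart `i`. -/
def dChart (A : AtlasData M) (i : A.ι) (p : M) (v : A.TangentSpace p) : A.E i :=
  dirDeriv (fun y => A.toFun i (A.invFun (A.idx p) y)) (A.toFun (A.idx p) p) v

/-- The differential `D_x φᵢ⁻¹ : E i → T_{φᵢ⁻¹ x} M` of the inverse chart at `x`. -/
def dChartInv (A : AtlasData M) (i : A.ι) (x : A.E i) (v : A.E i) :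
    A.TangentSpace (A.invFun i x) :=
  dirDeriv (fun y => A.toFun (A.idx (A.invFun i x)) (A.invFun i y)) x v

/-- The atlas of the tangent bundle `TM`; its charts are the maps
`Tφᵢ (p, v) = (φᵢ p, D_p φᵢ v)`. -/
def tangent (A : AtlasData M) : AtlasData A.TangentBundle where
  ι := A.ι
  E i := A.E i × A.E i
  instAddCommGroup _ := inferInstance
  instModule _ := inferInstance
  instTopologicalSpace _ := inferInstance
  instIsTopologicalAddGroup _ := inferInstance
  instContinuousSMul _ := inferInstance
  instLocallyConvexSpace _ := inferInstance
  instT2Space _ := inferInstance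
  source i := {z | z.1 ∈ A.source i}
  target i := A.target i ×ˢ univ
  toFun i z := (A.toFun i z.1, A.dChart i z.1 z.2)
  invFun i y := ⟨A.invFun i y.1, A.dChartInv i y.1 y.2⟩
  idx z := A.idx z.1

/-- The tangent map `T_p F : T_p M → T_{F p} N` of a map `F : M → N`. -/
def tangentMap (A : AtlasData M) (B : AtlasData N) (F : M → N) (p : M) (v : A.TangentSpace p) :
    B.TangentSpace (F p) :=
  dirDeriv (fun x => B.toFun (B.idx (F p)) (F (A.invFun (A.idx p) x))) (A.toFun (A.idx p) p) v

/-- The differential `D_p f : T_p M → ℝ` of a real function. -/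
def differential (A : AtlasData M) (f : M → ℝ) (p : M) (v : A.TangentSpace p) : ℝ :=
  dirDeriv (fun x => f (A.invFun (A.idx p) x)) (A.toFun (A.idx p) p) v

/-- Smooth real functions on `M`. -/
def IsSmoothFunction (A : AtlasData M) (f : M → ℝ) : Prop :=
  ∀ i, IsSmooth (fun x => f (A.invFun i x)) (A.target i)

/-- `C^k` curves `c : I → M` on an open interval `I`. -/
def IsCkCurve [TopologicalSpace M] (A : AtlasData M) (k : ℕ) (c : ℝ → M) (I : Set ℝ) : Prop :=
  ContinuousOn c I ∧ ∀ i, IsCk k (fun t => A.toFun i (c t)) (I ∩ c ⁻¹' A.source i)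

/-- Smooth curves `c : I → M` on an open interval `I`. -/
def IsSmoothCurve [TopologicalSpace M] (A : AtlasData M) (c : ℝ → M) (I : Set ℝ) : Prop :=
  ∀ k : ℕ, A.IsCkCurve k c I

/-- The local representative `Xᵢ : target i → E i` of a vector field `X` in the chart `i`. -/
def localVF (A : AtlasData M) (X : ∀ p, A.TangentSpace p) (i : A.ι) (x : A.E i) : A.E i :=
  A.dChart i (A.invFun i x) (X (A.invFun i x))

/-- `X` is a vector field of class `C^k`. -/
def IsCkVectorField (A : AtlasData M) (k : ℕ) (X : ∀ p, A.TangentSpace p) : Prop :=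
  ∀ i, IsCk k (A.localVF X i) (A.target i)

/-- `X` is a smooth vector field. -/
def IsSmoothVectorField (A : AtlasData M) (X : ∀ p, A.TangentSpace p) : Prop :=
  ∀ k : ℕ, A.IsCkVectorField k X

/-! ### Weak Riemannian metrics, sprays, Hesse manifolds -/

/-- A weak Riemannian metric on `M`: symmetric, positive definite bilinear forms on the tangent
spaces which define a smooth map `TM ⊕ TM → ℝ`. -/
structure WeakRiemannianMetric (A : AtlasData M) where
  form : ∀ p, A.TangentSpace p →ₗ[ℝ] A.TangentSpace p →ₗ[ℝ] ℝ
  symm : ∀ p v w, form p v w = form p w v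
  nonneg : ∀ p v, 0 ≤ form p v v
  definite : ∀ p v, form p v v = 0 → v = 0
  smooth : ∀ i, IsSmooth
    (fun z : A.E i × A.E i × A.E i =>
      form (A.invFun i z.1) (A.dChartInv i z.1 z.2.1) (A.dChartInv i z.1 z.2.2))
    (A.target i ×ˢ univ)

/-- The local representative `gᵢ(x, v, w)` of the metric in the chart `i`. -/
def WeakRiemannianMetric.loc {A : AtlasData M} (g : A.WeakRiemannianMetric) (i : A.ι)
    (x v w : A.E i) : ℝ :=
  g.form (A.invFun i x) (A.dChartInv i x v) (A.dChartInv i x w)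

/-- The bundle projection `π_M : TM → M`. -/
def proj (A : AtlasData M) (z : A.TangentBundle) : M := z.1

/-- The map `h_l : TM → TM`, multiplication by `l` in each fibre. -/
def fibreSMul (A : AtlasData M) (l : ℝ) (z : A.TangentBundle) : A.TangentBundle :=
  ⟨z.1, l • z.2⟩

/-- A spray: a smooth vector field `S : TM → T(TM)` on `TM` with `Tπ_M ∘ S = id` and
`S ∘ h_l = T h_l (l S)` for all real `l`. -/
structure IsSpray (A : AtlasData M) (S : ∀ z, A.tangent.TangentSpace z) : Prop where
  smooth : A.tangent.IsSmoothVectorField S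
  tangentMap_proj : ∀ z, A.tangent.tangentMap A A.proj z (S z) = z.2
  homogeneous : ∀ (l : ℝ) (z : A.TangentBundle),
    S (A.fibreSMul l z) = A.tangent.tangentMap A.tangent (A.fibreSMul l) z (l • S z)

/-- The component `S_{i,2}(x, v)` of the local representative
`(x, v) ↦ (x, v, v, S_{i,2}(x, v))` of a spray; it is the quadratic form `Γᵢ(x, v)`. -/
def sprayForm (A : AtlasData M) (S : ∀ z, A.tangent.TangentSpace z) (i : A.ι)
    (x v : A.E i) : A.E i :=
  Prod.snd (α := A.E i) (β := A.E i) (A.tangent.localVF S i (x, v))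

/-- The bilinear form `Bᵢ(x, v, w) = ½ d₂² S_{i,2}(x, 0; (v, w))` associated with a spray. -/
def sprayBilin (A : AtlasData M) (S : ∀ z, A.tangent.TangentSpace z) (i : A.ι)
    (x v w : A.E i) : A.E i :=
  (2⁻¹ : ℝ) • iterDirDeriv [w, v] (A.sprayForm S i x) 0

/-- `S` is a metric spray of `g`: a spray such that in every chart
`g(x, Γ(x, v), w) = ½ d₁g(x, v, v; w) - d₁g(x, v, w; v)`. -/
structure IsMetricSpray (A : AtlasData M) (g : A.WeakRiemannianMetric)
    (S : ∀ z, A.tangent.TangentSpace z) : Prop extends A.IsSpray S where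
  metric : ∀ i, ∀ x ∈ A.target i, ∀ v w : A.E i,
    g.loc i x (A.sprayForm S i x v) w =
      2⁻¹ * dirDeriv (fun y => g.loc i y v v) x w - dirDeriv (fun y => g.loc i y v w) x v

/-- The covariant derivative `∇_v X (p)` associated with the spray `S`, computed in the chosen chart
around `p` by the formula `dX(x; v) - B(x, v, X(x))`. -/
def covDeriv (A : AtlasData M) (S : ∀ z, A.tangent.TangentSpace z) (X : ∀ p, A.TangentSpace p)
    (p : M) (v : A.TangentSpace p) : A.TangentSpace p :=
  dirDeriv (A.localVF X (A.idx p)) (A.toFun (A.idx p) p) v -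
    A.sprayBilin S (A.idx p) (A.toFun (A.idx p) p) v
      (A.localVF X (A.idx p) (A.toFun (A.idx p) p))

/-! ### Gradients, Hessians, critical points -/

/-- `G` is the Riemannian gradient of `f`: `D_p f (v) = g_p(G p, v)` for all `p` and `v`. -/
def IsGradient (A : AtlasData M) (g : A.WeakRiemannianMetric) (f : M → ℝ)
    (G : ∀ p, A.TangentSpace p) : Prop :=
  ∀ p v, A.differential f p v = g.form p (G p) v

/-- The Riemannian Hessian `Hess f (p) : T_p M → T_p M`, `v ↦ ∇_v ∇f (p)`, of a function with
Riemannian gradient `gradf`, on a Hesse manifold with metric spray `S`. -/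
def hessian (A : AtlasData M) (S : ∀ z, A.tangent.TangentSpace z)
    (gradf : ∀ p, A.TangentSpace p) (p : M) (v : A.TangentSpace p) : A.TangentSpace p :=
  A.covDeriv S gradf p v

/-- `p` is a critical point of `f`: `(f ∘ γ)'(0) ≥ 0` for all `C¹` curves `γ` with `γ 0 = p`. -/
def IsCriticalPoint [TopologicalSpace M] (A : AtlasData M) (f : M → ℝ) (p : M) : Prop :=
  ∀ (I : Set ℝ) (γ : ℝ → M), IsOpen I → I.OrdConnected → (0 : ℝ) ∈ I → A.IsCkCurve 1 γ I →
    γ 0 = p → 0 ≤ deriv (fun t => f (γ t)) 0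

/-- `p` is a second-order critical point of `f`: it is a critical point and `(f ∘ c)''(0) ≥ 0` for
all smooth curves `c` with `c 0 = p`. -/
def IsSecondOrderCriticalPoint [TopologicalSpace M] (A : AtlasData M) (f : M → ℝ) (p : M) : Prop :=
  A.IsCriticalPoint f p ∧
    ∀ (I : Set ℝ) (c : ℝ → M), IsOpen I → I.OrdConnected → (0 : ℝ) ∈ I → A.IsSmoothCurve c I →
      c 0 = p → 0 ≤ iteratedDeriv 2 (fun t => f (c t)) 0

end AtlasData

end Bastiani

end

/-! Fix a point `p`, work in the chart around it, and write `u` for a curve and `G` for the gradient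
there. The chain rule and the gradient identity give `(f ∘ c)' = g(u; G(u), u')` near `0`. Hence `p`
is critical exactly when `g(G p, ·)` is nonnegative on all velocities; testing with `-G p` and using
definiteness, this means `G p = 0`.

At a zero of the gradient, `(f ∘ c)'(0) = 0`, and the difference quotient of `(f ∘ c)'` at `0`
equals `g(u(t); t⁻¹ G(u(t)), u'(t))` by homogeneity in the first slot. Its limit is `g(dG(u'(0)),
u'(0))` by joint continuity of `g`; the metric is never differentiated and the acceleration of `c`
never enters. The spray term `B(v, G)` vanishes at a zero of `G`, so `dG(v)` is the Hessian and `(f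
∘ c)''(0) = g(Hess f [c'(0)], c'(0))`: this is `iteratedDeriv_two_comp`. Since straight lines in the
chart realise every velocity (`exists_smooth_curve`), the equivalence follows.

The analytic input is the chain rule `IsCk.tendsto_slope_comp` in locally convex spaces, obtained
from a Hahn–Banach mean value inclusion. -/

noncomputable section

namespace Bastiani

/-! ### Bastiani calculus: mean value inclusion, chain rule, restriction to lines. -/

section Calculus

variable {E F : Type*} [AddCommGroup E] [Module ℝ E] [AddCommGroup F] [Module ℝ F]

theorem HasDirDeriv.dirDeriv_eq [TopologicalSpace F] [T2Space F] {f : E → F} {x v : E} {y : F}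
    (h : HasDirDeriv f x v y) : dirDeriv f x v = y :=
  Tendsto.limUnder_eq h

theorem hasDirDeriv_dirDeriv_of_exists [TopologicalSpace F] [T2Space F] {f : E → F} {x v : E}
    (h : ∃ y, HasDirDeriv f x v y) : HasDirDeriv f x v (dirDeriv f x v) := by
  obtain ⟨y, hy⟩ := h
  rwa [hy.dirDeriv_eq]

theorem hasDirDeriv_zero_right [TopologicalSpace F] (f : E → F) (x : E) :
    HasDirDeriv f x 0 0 := by
  simp [HasDirDeriv, tendsto_const_nhds]

theorem HasDirDeriv.smul [TopologicalSpace F] [ContinuousSMul ℝ F] {f : E → F} {x v : E} {y : F}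
    (h : HasDirDeriv f x v y) {r : ℝ} (hr : r ≠ 0) : HasDirDeriv f x (r • v) (r • y) := by
  have hmul : Tendsto (fun t : ℝ => t * r) (𝓝[≠] 0) (𝓝[≠] 0) := by
    refine tendsto_nhdsWithin_iff.2 ⟨?_, ?_⟩
    · have : Tendsto (fun t : ℝ => t * r) (𝓝 0) (𝓝 (0 * r)) := tendsto_id.mul_const r
      rw [zero_mul] at this
      exact this.mono_left nhdsWithin_le_nhds
    · filter_upwards [self_mem_nhdsWithin] with t ht
      exact mul_ne_zero ht hr
  have := (Tendsto.comp h hmul).const_smul r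
  refine this.congr fun t => ?_
  simp only [Function.comp_apply, smul_smul, mul_inv]
  rw [mul_comm t⁻¹, ← mul_assoc, mul_inv_cancel₀ hr, one_mul]

theorem tendsto_add_smul_nhds_zero [TopologicalSpace E] [ContinuousAdd E] [ContinuousSMul ℝ E]
    (x v : E) : Tendsto (fun t : ℝ => x + t • v) (𝓝 0) (𝓝 x) := by
  have : Continuous fun t : ℝ => x + t • v := by fun_prop
  simpa using this.tendsto 0

theorem HasDirDeriv.congr [TopologicalSpace E] [ContinuousAdd E] [ContinuousSMul ℝ E]
    [TopologicalSpace F] {f g : E → F} {x v : E} {y : F} (h : HasDirDeriv f x v y)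
    (hfg : f =ᶠ[𝓝 x] g) : HasDirDeriv g x v y := by
  refine Tendsto.congr' ?_ h
  filter_upwards [((tendsto_add_smul_nhds_zero x v).eventually hfg).filter_mono
    nhdsWithin_le_nhds] with t ht
  rw [ht, hfg.self_of_nhds]

theorem hasDirDeriv_id [TopologicalSpace E] (x v : E) : HasDirDeriv (fun y => y) x v v := by
  refine tendsto_const_nhds.congr' ?_
  filter_upwards [self_mem_nhdsWithin] with t ht
  rw [add_sub_cancel_left, inv_smul_smul₀ ht]

theorem hasDirDeriv_one_iff_hasDerivAt {f : ℝ → ℝ} {x y : ℝ} :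
    HasDirDeriv f x 1 y ↔ HasDerivAt f y x := by
  simp [HasDirDeriv, hasDerivAt_iff_tendsto_slope_zero]

theorem IsCk.exists_hasDirDeriv [TopologicalSpace E] [TopologicalSpace F] {f : E → F} {U : Set E}
    (hf : IsCk 1 f U) {x : E} (hx : x ∈ U) (v : E) : ∃ y, HasDirDeriv f x v y :=
  hf.1 [] (by simp) x hx v

theorem IsCk.hasDirDeriv [TopologicalSpace E] [TopologicalSpace F] [T2Space F] {f : E → F}
    {U : Set E} (hf : IsCk 1 f U) {x : E} (hx : x ∈ U) (v : E) :
    HasDirDeriv f x v (dirDeriv f x v) :=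
  hasDirDeriv_dirDeriv_of_exists (hf.exists_hasDirDeriv hx v)

theorem IsCk.continuousOn [TopologicalSpace E] [TopologicalSpace F] {k : ℕ} {f : E → F}
    {U : Set E} (hf : IsCk k f U) : ContinuousOn f U := by
  have h : ContinuousOn (fun z : E × (Fin 0 → E) => f z.1) (U ×ˢ univ) := hf.2 0 (Nat.zero_le k)
  exact h.comp (f := fun x : E => (x, Fin.elim0)) (by fun_prop) fun x hx => ⟨hx, mem_univ _⟩

theorem IsCk.continuousOn_dirDeriv [TopologicalSpace E] [TopologicalSpace F] {f : E → F}
    {U : Set E} (hf : IsCk 1 f U) :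
    ContinuousOn (fun z : E × E => dirDeriv f z.1 z.2) (U ×ˢ univ) := by
  have h : ContinuousOn (fun z : E × (Fin 1 → E) => dirDeriv f z.1 (z.2 0)) (U ×ˢ univ) :=
    hf.2 1 le_rfl
  exact h.comp (f := fun z : E × E => (z.1, fun _ => z.2)) (by fun_prop)
    fun x hx => ⟨hx.1, mem_univ _⟩

/-- The mean value inclusion: a difference quotient of `f` along a segment lies in every closed
convex set containing the directional derivatives along the segment. -/
theorem slope_mem_of_dirDeriv_mem [TopologicalSpace F] [IsTopologicalAddGroup F]
    [ContinuousSMul ℝ F] [LocallyConvexSpace ℝ F] {f : E → F} {f' : E → F} {x v : E} {t : ℝ}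
    (ht : t ≠ 0) {C : Set F} (hconv : Convex ℝ C) (hclosed : IsClosed C)
    (hf : ∀ s ∈ Icc (0 : ℝ) 1, HasDirDeriv f (x + (s * t) • v) v (f' (x + (s * t) • v)))
    (hC : ∀ s ∈ Icc (0 : ℝ) 1, f' (x + (s * t) • v) ∈ C) :
    t⁻¹ • (f (x + t • v) - f x) ∈ C := by
  -- A slope outside `C` is strictly separated from `C` by a continuous functional `l`. The scalar
  -- mean value theorem for `l ∘ f` on the segment makes `l` of the slope a value of `l` on `C`, a
  -- contradiction.
  by_contra hmem
  obtain ⟨l, u, hlC, hul⟩ := geometric_hahn_banach_closed_point hconv hclosed hmem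
  have hder : ∀ s ∈ Icc (0 : ℝ) 1, HasDerivAt (fun s : ℝ => l (f (x + (s * t) • v)))
      (l (f' (x + (s * t) • v)) * t) s := by
    intro s hs
    have h1 : HasDerivAt (fun r : ℝ => l (f (x + r • v))) (l (f' (x + (s * t) • v))) (s * t) := by
      rw [hasDerivAt_iff_tendsto_slope_zero]
      refine ((l.continuous.tendsto _).comp (hf s hs)).congr fun r => ?_
      simp [add_smul, add_assoc]
    have h2 := h1.comp s ((hasDerivAt_id s).mul_const t)
    rw [one_mul] at h2
    exact h2
  obtain ⟨s, hs, heq⟩ := exists_hasDerivAt_eq_slope _ _ (zero_lt_one (α := ℝ))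
    (fun s hs => (hder s hs).continuousAt.continuousWithinAt)
    (fun s hs => hder s (Ioo_subset_Icc_self hs))
  have h2 := hlC _ (hC s (Ioo_subset_Icc_self hs))
  simp only [one_mul, zero_mul, zero_smul, add_zero, sub_zero, div_one] at heq
  rw [map_smul, map_sub, ← heq, smul_eq_mul, mul_comm, mul_inv_cancel_right₀ ht] at hul
  exact absurd hul (not_lt.2 h2.le)

/-- The chain rule for a `C¹` map along a curve. -/
theorem IsCk.tendsto_slope_comp [TopologicalSpace E] [IsTopologicalAddGroup E]
    [ContinuousSMul ℝ E] [LocallyConvexSpace ℝ E] [TopologicalSpace F] [IsTopologicalAddGroup F]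
    [ContinuousSMul ℝ F] [LocallyConvexSpace ℝ F] [T2Space F] {f : E → F} {U : Set E}
    (hU : IsOpen U) (hf : IsCk 1 f U) {γ : ℝ → E} {x v : E} (hx : x ∈ U)
    (hγ : Tendsto (fun t : ℝ => t⁻¹ • (γ t - x)) (𝓝[≠] 0) (𝓝 v)) :
    Tendsto (fun t : ℝ => t⁻¹ • (f (γ t) - f x)) (𝓝[≠] 0) (𝓝 (dirDeriv f x v)) := by
  refine tendsto_def.2 fun N hN => ?_
  obtain ⟨N', hN', hN'c, hN'N⟩ := exists_mem_nhds_isClosed_subset hN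
  obtain ⟨C, ⟨hC, hCconv⟩, hCN'⟩ :=
    (LocallyConvexSpace.convex_basis (𝕜 := ℝ) (dirDeriv f x v)).mem_iff.1 hN'
  have hcont : ContinuousAt (fun z : E × E => dirDeriv f z.1 z.2) (x, v) :=
    hf.continuousOn_dirDeriv.continuousAt
      ((hU.prod isOpen_univ).mem_nhds ⟨hx, mem_univ _⟩)
  have hpre := hcont.preimage_mem_nhds hC
  rw [nhds_prod_eq, mem_prod_iff] at hpre
  obtain ⟨A, hA, B, hB, hAB⟩ := hpre
  -- `K` is taken convex so that it contains the whole segment from `x` to `γ t`, where the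
  -- derivative must be controlled.
  obtain ⟨K, ⟨hK, hKconv⟩, hKA⟩ :=
    (LocallyConvexSpace.convex_basis (𝕜 := ℝ) x).mem_iff.1 (inter_mem hA (hU.mem_nhds hx))
  -- For `t ≠ 0` the point `γ t` is `x + t • w` with `w` the difference quotient. This yields `γ t →
  -- x` without assuming continuity, and reduces the claim to a slope of `f` along a segment in the
  -- varying direction `w`.
  have hγx : Tendsto (fun t : ℝ => x + t • (t⁻¹ • (γ t - x))) (𝓝[≠] 0) (𝓝 x) := by
    have h0 : Tendsto (fun t : ℝ => t) (𝓝[≠] 0) (𝓝 0) := nhdsWithin_le_nhds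
    simpa using tendsto_const_nhds.add (h0.smul hγ)
  have hne : ∀ᶠ t : ℝ in 𝓝[≠] 0, t ≠ 0 := self_mem_nhdsWithin
  filter_upwards [hγ.eventually_mem hB, hγx.eventually_mem hK, hne] with t htB htK ht0
  have hseg : ∀ s ∈ Icc (0 : ℝ) 1, x + (s * t) • (t⁻¹ • (γ t - x)) ∈ K := by
    intro s hs
    have := hKconv.add_smul_sub_mem (mem_of_mem_nhds hK) htK hs
    rwa [add_sub_cancel_left, smul_smul s t] at this
  have hmemC : ∀ s ∈ Icc (0 : ℝ) 1,
      dirDeriv f (x + (s * t) • (t⁻¹ • (γ t - x))) (t⁻¹ • (γ t - x)) ∈ closure C := by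
    intro s hs
    have h1 := hAB (Set.mk_mem_prod (hKA (hseg s hs)).1 htB)
    exact subset_closure h1
  have hmem : t⁻¹ • (f (x + t • (t⁻¹ • (γ t - x))) - f x) ∈ closure C :=
    slope_mem_of_dirDeriv_mem (f' := fun z => dirDeriv f z (t⁻¹ • (γ t - x))) ht0
      hCconv.closure isClosed_closure (fun s hs => hf.hasDirDeriv (hKA (hseg s hs)).2 _) hmemC
  rw [smul_inv_smul₀ ht0, add_sub_cancel] at hmem
  exact hN'N (closure_minimal hCN' hN'c hmem)

/-- The chain rule. -/
theorem IsCk.hasDirDeriv_comp {D : Type*} [AddCommGroup D] [Module ℝ D] [TopologicalSpace E]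
    [IsTopologicalAddGroup E] [ContinuousSMul ℝ E] [LocallyConvexSpace ℝ E] [TopologicalSpace F]
    [IsTopologicalAddGroup F] [ContinuousSMul ℝ F] [LocallyConvexSpace ℝ F] [T2Space F]
    {f : E → F} {U : Set E} (hU : IsOpen U) (hf : IsCk 1 f U) {h : D → E} {x v : D} {w : E}
    (hx : h x ∈ U) (hh : HasDirDeriv h x v w) :
    HasDirDeriv (fun y => f (h y)) x v (dirDeriv f (h x) w) :=
  hf.tendsto_slope_comp hU hx hh

/-- The difference quotients on the two sides agree term by term, so their `limUnder` values agree
whether or not the limits exist. -/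
theorem iterDirDeriv_comp_line [TopologicalSpace F] (f : E → F) (x v : E) (ss : List ℝ) (t : ℝ) :
    iterDirDeriv ss (fun t : ℝ => f (x + t • v)) t =
      iterDirDeriv (ss.map (· • v)) f (x + t • v) := by
  induction ss generalizing t with
  | nil => rfl
  | cons s ss ih =>
    simp only [List.map_cons, iterDirDeriv, dirDeriv, ih]
    simp only [add_smul, smul_smul, smul_eq_mul, add_assoc]

theorem IsCk.comp_line [TopologicalSpace E] [ContinuousAdd E] [ContinuousSMul ℝ E]
    [TopologicalSpace F] {k : ℕ} {f : E → F} {U : Set E} (hf : IsCk k f U) (x v : E)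
    {J : Set ℝ} (hJ : ∀ t ∈ J, x + t • v ∈ U) : IsCk k (fun t : ℝ => f (x + t • v)) J := by
  refine ⟨fun ss hss t ht s => ?_, fun j hj => ?_⟩
  · obtain ⟨y, hy⟩ := hf.1 (ss.map (· • v)) (by simpa using hss) _ (hJ t ht) (s • v)
    refine ⟨y, ?_⟩
    refine Tendsto.congr (fun r => ?_) hy
    simp only [iterDirDeriv_comp_line, add_smul, smul_smul, smul_eq_mul, add_assoc]
  · have := (hf.2 j hj).comp (f := fun z : ℝ × (Fin j → ℝ) => (x + z.1 • v, fun i => z.2 i • v))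
      (s := J ×ˢ univ) (by fun_prop) fun z hz => ⟨hJ _ hz.1, mem_univ _⟩
    refine this.congr fun z _ => ?_
    simp only [iterDirDeriv_comp_line, List.map_ofFn, Function.comp_apply]
    rfl

end Calculus

/-! ### Local representatives of tangent vectors, metric and gradient. -/

namespace AtlasData

variable {M : Type u} {A : AtlasData.{u, v, w} M}

/-- The last argument is the direction of the outer derivative, and every difference quotient in
direction `0` vanishes; no regularity of `S` is involved. -/
theorem sprayBilin_zero_right (S : ∀ z, A.tangent.TangentSpace z) (i : A.ι) (x v : A.E i) :
    A.sprayBilin S i x v 0 = 0 := by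
  simp [sprayBilin, iterDirDeriv, (hasDirDeriv_zero_right _ _).dirDeriv_eq]

/-- Tangent spaces at propositionally equal points are different types. Writing the chart
differentials out with `p` in place of `A.invFun i y` lets the base point be substituted. -/
theorem WeakRiemannianMetric.loc_eq_form (g : A.WeakRiemannianMetric) {i : A.ι} {y : A.E i} {p : M}
    (h : A.invFun i y = p) (v w : A.E i) :
    g.loc i y v w =
      g.form p (dirDeriv (fun z => A.toFun (A.idx p) (A.invFun i z)) y v)
        (dirDeriv (fun z => A.toFun (A.idx p) (A.invFun i z)) y w) := by
  subst h
  rfl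

variable [TopologicalSpace M]

theorem IsManifold.isOpen_overlap (hA : A.IsManifold) (i j : A.ι) :
    IsOpen (A.target i ∩ A.invFun i ⁻¹' A.source j) :=
  (hA.continuousOn_invFun i).isOpen_inter_preimage (hA.isOpen_target i) (hA.isOpen_source j)

theorem IsManifold.eventually_left_inv (hA : A.IsManifold) (i j : A.ι) {y : A.E i}
    (hy : y ∈ A.target i) (hj : A.invFun i y ∈ A.source j) :
    ∀ᶠ z in 𝓝 y, A.invFun j (A.toFun j (A.invFun i z)) = A.invFun i z := by
  filter_upwards [(hA.isOpen_overlap i j).mem_nhds ⟨hy, hj⟩] with z hz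
  exact hA.left_inv j _ hz.2

theorem IsManifold.hasDirDeriv_dChart (hA : A.IsManifold) {i : A.ι} {p : M} (hp : p ∈ A.source i)
    (v : A.TangentSpace p) :
    HasDirDeriv (fun z => A.toFun i (A.invFun (A.idx p) z)) (A.toFun (A.idx p) p) v
      (A.dChart i p v) := by
  refine (hA.smooth_transition (A.idx p) i 1).hasDirDeriv ⟨?_, ?_⟩ v
  · exact hA.mapsTo_toFun _ (hA.mem_source_idx p)
  · rwa [mem_preimage, hA.left_inv _ _ (hA.mem_source_idx p)]

theorem IsManifold.hasDirDeriv_dChartInv (hA : A.IsManifold) {i : A.ι} {y : A.E i}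
    (hy : y ∈ A.target i) (w : A.E i) :
    HasDirDeriv (fun z => A.toFun (A.idx (A.invFun i y)) (A.invFun i z)) y w
      (A.dChartInv i y w) :=
  (hA.smooth_transition i (A.idx (A.invFun i y)) 1).hasDirDeriv
    ⟨hy, hA.mem_source_idx (A.invFun i y)⟩ w

/-- Used to pull `t⁻¹` out of the metric in the second-derivative computation; only nonzero scalars
occur there, so full linearity of the chart differential can be avoided. -/
theorem IsManifold.dChartInv_smul (hA : A.IsManifold) {i : A.ι} {y : A.E i}
    (hy : y ∈ A.target i) {r : ℝ} (hr : r ≠ 0) (w : A.E i) :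
    A.dChartInv i y (r • w) = r • A.dChartInv i y w :=
  ((hA.hasDirDeriv_dChartInv hy w).smul hr).dirDeriv_eq

/-- The two transition maps compose to the identity near the point, so the chain rule makes their
differentials compose to the identity. -/
theorem IsManifold.dChartInv_dChart (hA : A.IsManifold) {i : A.ι} {y : A.E i}
    (hy : y ∈ A.target i) (v : A.TangentSpace (A.invFun i y)) :
    A.dChartInv i y (A.dChart i (A.invFun i y) v) = v := by
  have hpi := hA.mapsTo_invFun i hy
  have hpk := hA.mem_source_idx (A.invFun i y)
  have hpt := hA.mapsTo_toFun _ hpk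
  have hback : A.toFun i (A.invFun (A.idx (A.invFun i y))
      (A.toFun (A.idx (A.invFun i y)) (A.invFun i y))) = y := by
    rw [hA.left_inv _ _ hpk, hA.right_inv i y hy]
  have hcomp := (hA.smooth_transition i (A.idx (A.invFun i y)) 1).hasDirDeriv_comp
    (hA.isOpen_overlap _ _)
    (h := fun z => A.toFun i (A.invFun (A.idx (A.invFun i y)) z))
    (by simp only [hback]; exact ⟨hy, hpk⟩) (hA.hasDirDeriv_dChart hpi v)
  simp only [hback] at hcomp
  have hid : HasDirDeriv (fun z => z) (A.toFun (A.idx (A.invFun i y)) (A.invFun i y)) v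
      (A.dChartInv i y (A.dChart i (A.invFun i y) v)) := by
    refine hcomp.congr ?_
    filter_upwards [hA.eventually_left_inv (A.idx (A.invFun i y)) i hpt
      (by rwa [hA.left_inv _ _ hpk]), (hA.isOpen_target _).mem_nhds hpt] with z hz hzt
    rw [hz, hA.right_inv _ _ hzt]
  exact hid.dirDeriv_eq.symm.trans (hasDirDeriv_id _ _).dirDeriv_eq

theorem IsManifold.dirDeriv_eq_differential (hA : A.IsManifold) {f : M → ℝ}
    (hf : A.IsSmoothFunction f) {i : A.ι} {y : A.E i} (hy : y ∈ A.target i) (w : A.E i) :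
    dirDeriv (fun z => f (A.invFun i z)) y w =
      A.differential f (A.invFun i y) (A.dChartInv i y w) := by
  have hpk := hA.mem_source_idx (A.invFun i y)
  have hcomp := (hf (A.idx (A.invFun i y)) 1).hasDirDeriv_comp (hA.isOpen_target _)
    (h := fun z => A.toFun (A.idx (A.invFun i y)) (A.invFun i z)) (hA.mapsTo_toFun _ hpk)
    (hA.hasDirDeriv_dChartInv hy w)
  refine (hcomp.congr ?_).dirDeriv_eq
  filter_upwards [hA.eventually_left_inv i _ hy hpk] with z hz
  rw [hz]

/-- Carries the gradient identity from the preferred chart at each point to one fixed chart, where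
the base point may vary. -/
theorem IsManifold.dirDeriv_eq_loc (hA : A.IsManifold) {g : A.WeakRiemannianMetric} {f : M → ℝ}
    (hf : A.IsSmoothFunction f) {G : ∀ p, A.TangentSpace p} (hG : A.IsGradient g f G)
    {i : A.ι} {y : A.E i} (hy : y ∈ A.target i) (w : A.E i) :
    dirDeriv (fun z => f (A.invFun i z)) y w = g.loc i y (A.localVF G i y) w := by
  rw [hA.dirDeriv_eq_differential hf hy, hG, WeakRiemannianMetric.loc, localVF,
    hA.dChartInv_dChart hy]

theorem IsManifold.toFun_idx_mem (hA : A.IsManifold) (p : M) :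
    A.toFun (A.idx p) p ∈ A.target (A.idx p) :=
  hA.mapsTo_toFun _ (hA.mem_source_idx p)

theorem IsManifold.invFun_toFun_idx (hA : A.IsManifold) (p : M) :
    A.invFun (A.idx p) (A.toFun (A.idx p) p) = p :=
  hA.left_inv _ _ (hA.mem_source_idx p)

theorem IsManifold.dirDeriv_chart_idx (hA : A.IsManifold) (p : M) (v : A.TangentSpace p) :
    dirDeriv (fun z => A.toFun (A.idx p) (A.invFun (A.idx p) z)) (A.toFun (A.idx p) p) v = v := by
  refine ((hasDirDeriv_id _ v).congr ?_).dirDeriv_eq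
  filter_upwards [(hA.isOpen_target _).mem_nhds (hA.toFun_idx_mem p)] with z hz
  exact (hA.right_inv _ _ hz).symm

theorem IsManifold.loc_idx (hA : A.IsManifold) (g : A.WeakRiemannianMetric) (p : M)
    (v w : A.TangentSpace p) :
    g.loc (A.idx p) (A.toFun (A.idx p) p) v w = g.form p v w := by
  rw [g.loc_eq_form (hA.invFun_toFun_idx p), hA.dirDeriv_chart_idx, hA.dirDeriv_chart_idx]

theorem IsManifold.localVF_idx (hA : A.IsManifold) (G : ∀ p, A.TangentSpace p) (p : M) :
    A.localVF G (A.idx p) (A.toFun (A.idx p) p) = G p := by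
  -- Generalising the base point to `q` makes the dependent value `G q` amenable to substitution.
  have h : ∀ q, q = p → A.dChart (A.idx p) q (G q) = G p := by
    rintro q rfl
    exact hA.dirDeriv_chart_idx q (G q)
  exact h _ (hA.invFun_toFun_idx p)

theorem IsManifold.hessian_eq (hA : A.IsManifold) (S : ∀ z, A.tangent.TangentSpace z)
    {G : ∀ p, A.TangentSpace p} {p : M} (h : G p = 0) (v : A.TangentSpace p) :
    A.hessian S G p v = dirDeriv (A.localVF G (A.idx p)) (A.toFun (A.idx p) p) v := by
  rw [hessian, covDeriv, hA.localVF_idx, h, sprayBilin_zero_right, sub_zero]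

/-! ### Derivatives of the function along curves. -/

/-- The velocity of a curve, read in the chart around a base point `p`. -/
def velocity (A : AtlasData.{u, v, w} M) (p : M) (c : ℝ → M) (t : ℝ) : A.TangentSpace p :=
  dirDeriv (fun s => A.toFun (A.idx p) (c s)) t 1

theorem IsCkCurve.isOpen_preimage_source (hA : A.IsManifold) {k : ℕ} {c : ℝ → M} {I : Set ℝ}
    (hI : IsOpen I) (hc : A.IsCkCurve k c I) (i : A.ι) : IsOpen (I ∩ c ⁻¹' A.source i) :=
  hc.1.isOpen_inter_preimage hI (hA.isOpen_source i)

/-- The chart stays fixed at `p` while `t` varies, so the formula holds on a neighbourhood of a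
given time and can be differentiated again. -/
theorem IsCkCurve.hasDerivAt_comp (hA : A.IsManifold) {g : A.WeakRiemannianMetric} {f : M → ℝ}
    (hf : A.IsSmoothFunction f) {G : ∀ p, A.TangentSpace p} (hG : A.IsGradient g f G)
    {c : ℝ → M} {I : Set ℝ} (hI : IsOpen I) (hc : A.IsCkCurve 1 c I) (p : M) {t : ℝ} (ht : t ∈ I)
    (htp : c t ∈ A.source (A.idx p)) :
    HasDerivAt (fun s => f (c s))
      (g.loc (A.idx p) (A.toFun (A.idx p) (c t))
        (A.localVF G (A.idx p) (A.toFun (A.idx p) (c t))) (A.velocity p c t)) t := by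
  have hmem : t ∈ I ∩ c ⁻¹' A.source (A.idx p) := ⟨ht, htp⟩
  have hct := hA.mapsTo_toFun _ htp
  have hu : HasDirDeriv (fun s => A.toFun (A.idx p) (c s)) t 1 (A.velocity p c t) :=
    (hc.2 (A.idx p)).hasDirDeriv hmem 1
  have h := (hf (A.idx p) 1).hasDirDeriv_comp (hA.isOpen_target _)
    (h := fun s => A.toFun (A.idx p) (c s)) hct hu
  rw [hA.dirDeriv_eq_loc hf hG hct] at h
  refine hasDirDeriv_one_iff_hasDerivAt.1 (h.congr ?_)
  filter_upwards [(hc.isOpen_preimage_source hA hI (A.idx p)).mem_nhds hmem] with s hs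
  rw [hA.left_inv _ _ hs.2]

theorem IsCkCurve.hasDerivAt_comp_zero (hA : A.IsManifold) {g : A.WeakRiemannianMetric}
    {f : M → ℝ} (hf : A.IsSmoothFunction f) {G : ∀ p, A.TangentSpace p} (hG : A.IsGradient g f G)
    {c : ℝ → M} {I : Set ℝ} (hI : IsOpen I) (h0 : (0 : ℝ) ∈ I) (hc : A.IsCkCurve 1 c I) :
    HasDerivAt (fun s => f (c s)) (g.form (c 0) (G (c 0)) (A.velocity (c 0) c 0)) 0 := by
  have h := hc.hasDerivAt_comp hA hf hG hI (c 0) h0 (hA.mem_source_idx _)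
  rwa [hA.localVF_idx, hA.loc_idx] at h

/-- The second derivative of `f` along a curve through a zero of its gradient. -/
theorem IsCkCurve.iteratedDeriv_two_comp (hA : A.IsManifold) {g : A.WeakRiemannianMetric}
    (S : ∀ z, A.tangent.TangentSpace z) {f : M → ℝ} (hf : A.IsSmoothFunction f)
    {G : ∀ p, A.TangentSpace p} (hG : A.IsGradient g f G) (hG1 : A.IsCkVectorField 1 G)
    {c : ℝ → M} {I : Set ℝ} (hI : IsOpen I) (h0 : (0 : ℝ) ∈ I) (hc : A.IsCkCurve 1 c I)
    (hcrit : G (c 0) = 0) :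
    iteratedDeriv 2 (fun t => f (c t)) 0 =
      g.form (c 0) (A.hessian S G (c 0) (A.velocity (c 0) c 0)) (A.velocity (c 0) c 0) := by
  set p := c 0 with hp
  set i := A.idx p
  set u : ℝ → A.E i := fun t => A.toFun i (c t) with hu
  have hJ := hc.isOpen_preimage_source hA hI i
  have h0J : (0 : ℝ) ∈ I ∩ c ⁻¹' A.source i := ⟨h0, hA.mem_source_idx _⟩
  have hu0 : u 0 ∈ A.target i := hA.toFun_idx_mem p
  have hder : ∀ᶠ t in 𝓝 (0 : ℝ), deriv (fun t => f (c t)) t =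
      g.loc i (u t) (A.localVF G i (u t)) (A.velocity p c t) := by
    filter_upwards [hJ.mem_nhds h0J] with t ht
    exact (hc.hasDerivAt_comp hA hf hG hI p ht.1 ht.2).deriv
  have hd0 : deriv (fun t => f (c t)) 0 = 0 := by
    rw [(hc.hasDerivAt_comp_zero hA hf hG hI h0).deriv, ← hp, hcrit, map_zero,
      LinearMap.zero_apply]
  have hG0 : A.localVF G i (u 0) = 0 := (hA.localVF_idx G p).trans hcrit
  -- As `G` vanishes at `u 0`, `t⁻¹ • G(u t)` is itself a difference quotient, and the chain rule
  -- gives its limit.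
  have hGu : Tendsto (fun t : ℝ => t⁻¹ • A.localVF G i (u t)) (𝓝[≠] 0)
      (𝓝 (dirDeriv (A.localVF G i) (u 0) (A.velocity p c 0))) := by
    have := (hG1 i).hasDirDeriv_comp (hA.isOpen_target i) hu0 ((hc.2 i).hasDirDeriv h0J 1)
    refine Tendsto.congr (fun t => ?_) this
    simp only [zero_add, smul_eq_mul, mul_one]
    rw [show A.localVF G i (A.toFun i (c 0)) = 0 from hG0, sub_zero]
  have hucont : ContinuousAt u 0 := (hc.2 i).continuousOn.continuousAt (hJ.mem_nhds h0J)
  have hvel : ContinuousAt (fun t => A.velocity p c t) 0 := by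
    have := ((hc.2 i).continuousOn_dirDeriv.comp (f := fun t : ℝ => (t, (1 : ℝ))) (by fun_prop)
      fun t ht => ⟨ht, mem_univ _⟩)
    exact this.continuousAt (hJ.mem_nhds h0J)
  -- Only order `0` of the smoothness of `g` is used: joint continuity in the base point and both
  -- vectors.
  have hlim := ((g.smooth i 0).continuousOn.continuousAt
    (((hA.isOpen_target i).prod isOpen_univ).mem_nhds
      (show (u 0, dirDeriv (A.localVF G i) (u 0) (A.velocity p c 0), A.velocity p c 0) ∈
        A.target i ×ˢ univ from ⟨hu0, mem_univ _⟩))).tendsto.comp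
    ((hucont.tendsto.mono_left nhdsWithin_le_nhds).prodMk_nhds
      (hGu.prodMk_nhds (hvel.tendsto.mono_left nhdsWithin_le_nhds)))
  rw [iteratedDeriv_succ, iteratedDeriv_one]
  refine HasDerivAt.deriv ?_
  rw [hA.hessian_eq S hcrit, ← hA.loc_idx, hasDerivAt_iff_tendsto_slope_zero]
  refine hlim.congr' ?_
  filter_upwards [hder.filter_mono nhdsWithin_le_nhds, self_mem_nhdsWithin,
    mem_nhdsWithin_of_mem_nhds (hJ.mem_nhds h0J)] with t ht ht0 htJ
  rw [zero_add, ht, hd0, sub_zero]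
  simp only [Function.comp_apply, WeakRiemannianMetric.loc]
  rw [hA.dChartInv_smul (hA.mapsTo_toFun i htJ.2) (inv_ne_zero ht0), map_smul,
    LinearMap.smul_apply]

/-- Every tangent vector is the velocity of a smooth curve. -/
theorem IsManifold.exists_smooth_curve (hA : A.IsManifold) (p : M) (v : A.TangentSpace p) :
    ∃ (I : Set ℝ) (c : ℝ → M), IsOpen I ∧ I.OrdConnected ∧ (0 : ℝ) ∈ I ∧ A.IsSmoothCurve c I ∧
      c 0 = p ∧ A.velocity p c 0 = v := by
  set i := A.idx p
  set x : A.E i := A.toFun i p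
  have hx : x ∈ A.target i := hA.toFun_idx_mem p
  have hev : ∀ᶠ t : ℝ in 𝓝 0, x + t • v ∈ A.target i :=
    (tendsto_add_smul_nhds_zero x v).eventually ((hA.isOpen_target i).mem_nhds hx)
  -- The curve is the chart line `x + t • v`, with `ε` small enough that it stays in the chart's
  -- target.
  obtain ⟨ε, hε, hball⟩ := Metric.eventually_nhds_iff_ball.1 hev
  refine ⟨Metric.ball 0 ε, fun t => A.invFun i (x + t • v), Metric.isOpen_ball, ?_,
    Metric.mem_ball_self hε, fun k => ⟨?_, fun j => ?_⟩, ?_, ?_⟩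
  · rw [Real.ball_eq_Ioo]
    exact ordConnected_Ioo
  · exact (hA.continuousOn_invFun i).comp (by fun_prop) fun t ht => hball t ht
  · exact (hA.smooth_transition i j k).comp_line x v fun t ht => ⟨hball t ht.1, ht.2⟩
  · simpa using hA.invFun_toFun_idx p
  · refine HasDirDeriv.dirDeriv_eq ?_
    refine tendsto_const_nhds.congr' ?_
    filter_upwards [hev.filter_mono nhdsWithin_le_nhds, self_mem_nhdsWithin] with t ht ht0
    simp only [zero_add, smul_eq_mul, mul_one, zero_smul, add_zero]
    rw [hA.right_inv i _ ht, hA.right_inv i _ hx, add_sub_cancel_left, inv_smul_smul₀ ht0]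

/-! ### Critical points and the equivalence. -/

theorem IsManifold.isCriticalPoint_iff (hA : A.IsManifold) {g : A.WeakRiemannianMetric}
    {f : M → ℝ} (hf : A.IsSmoothFunction f) {G : ∀ p, A.TangentSpace p} (hG : A.IsGradient g f G)
    (p : M) : A.IsCriticalPoint f p ↔ G p = 0 := by
  constructor
  · intro h
    -- Velocity `-G p` turns the one-sided condition into `0 ≤ -g(G p, G p)`, which forces `G p =
    -- 0`.
    obtain ⟨I, c, hI, hIc, h0, hc, hc0, hv⟩ := hA.exists_smooth_curve p (-G p)
    have hnn := h I c hI hIc h0 (hc 1) hc0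
    rw [((hc 1).hasDerivAt_comp_zero hA hf hG hI h0).deriv] at hnn
    subst hc0
    rw [hv, map_neg] at hnn
    exact g.definite _ _ (le_antisymm (by linarith) (g.nonneg _ _))
  · rintro h I c hI - h0 hc rfl
    rw [(hc.hasDerivAt_comp_zero hA hf hG hI h0).deriv, h]
    simp

end AtlasData

end Bastiani

end

theorem mainTheorem4 {M : Type u} [TopologicalSpace M] [T2Space M]
    (A : Bastiani.AtlasData.{u, v, w} M) (hA : A.IsManifold)
    (g : A.WeakRiemannianMetric)
    (S : ∀ z, A.tangent.TangentSpace z) (hS : A.IsMetricSpray g S)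
    (f : M → ℝ) (hf : A.IsSmoothFunction f)
    (gradf : ∀ p, A.TangentSpace p) (hgrad : A.IsGradient g f gradf)
    (hgradC1 : A.IsCkVectorField 1 gradf) (x : M) :
    A.IsSecondOrderCriticalPoint f x ↔
      gradf x = 0 ∧ ∀ v : A.TangentSpace x, 0 ≤ g.form x (A.hessian S gradf x v) v := by
  rw [Bastiani.AtlasData.IsSecondOrderCriticalPoint, hA.isCriticalPoint_iff hf hgrad]
  refine and_congr_right fun hx => ⟨fun h v => ?_, ?_⟩
  · obtain ⟨I, c, hI, hIc, h0, hc, rfl, rfl⟩ := hA.exists_smooth_curve x v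
    have := h I c hI hIc h0 hc rfl
    rwa [(hc 1).iteratedDeriv_two_comp hA S hf hgrad hgradC1 hI h0 hx] at this
  · rintro h I c hI - h0 hc rfl
    rw [(hc 1).iteratedDeriv_two_comp hA S hf hgrad hgradC1 hI h0 hx]
    exact h _
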